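/- Let $N\ge 0$ be an integer and let $p_i, c_i, \xi_{i0}\in\mathbb{C}$ ($1\le i\le 2N$) satisfy $p_i+p_j\ne 0$ for all $1\le i,j\le 2N$ (in particular $p_i\neq 0$), $p_i^2-p_ip_{2N+1-i}+p_{2N+1-i}^2=0$ and $c_i=-c_{2N+1-i}$ for all $1\le i\le 2N$. For real variables $x_1,x_{-1}$ put $$\xi_i=p_ix_1+\frac{1}{p_i}x_{-1}+\xi_{i0},\qquad c_{i,j}=\delta_{j,2N+1-i}\,c_i,$$ and for $n\in\mathbb{Z}$ let $$\tau_n=\det\left(\psi^{(n)}_{i,j}\right)_{1\le i,j\le 2N},\qquad \psi^{(n)}_{i,j}=c_{i,j}+\frac{2p_i}{p_i+p_j}\left(-\frac{p_i}{p_j}\right)^{n-1}e^{\xi_i+\xi_j}.$$ Then the functions $\tau_n$ are smooth functions of $(x_1,x_{-1})\in\mathbb{R}^2$, $\tau_1$ and $\tau_2$ solve the bilinear equations of the period-3 reduction of the $B_\infty$ two-dimensional Toda system, $$-\left(\tfrac12 D_{x_1}D_{x_{-1}}-1\right)\tau_1\cdot\tau_1=\tau_1\tau_2,\qquad -\left(\tfrac12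 D_{x_1}D_{x_{-1}}-1\right)\tau_2\cdot\tau_2=\tau_1^2,$$ and $\tau_{n+3}=\tau_n$ for all $n\in\mathbb{Z}$. Here $D$ is the Hirota operator, $$D_{x_1}D_{x_{-1}}\,a\cdot b=\left(\partial_{x_1}-\partial_{x_1'}\right)\left(\partial_{x_{-1}}-\partial_{x_{-1}'}\right)a(x_1,x_{-1})\,b(x_1',x_{-1}')\Big|_{x_1'=x_1,\;x_{-1}'=x_{-1}}.$$ -/

import Mathlib

open scoped ContDiff

noncomputable section

/-- For a function `F x x'` of two points `x = (x₁, x₋₁)` and `x' = (x₁', x₋₁')` of the plane,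
the operator `∂/∂x₁ - ∂/∂x₁'`. -/
def hirotaDiffPos (F : ℝ × ℝ → ℝ × ℝ → ℂ) : ℝ × ℝ → ℝ × ℝ → ℂ := fun x x' =>
  deriv (fun s : ℝ => F (s, x.2) x') x.1 - deriv (fun s : ℝ => F x (s, x'.2)) x'.1

/-- For a function `F x x'` of two points `x = (x₁, x₋₁)` and `x' = (x₁', x₋₁')` of the plane,
the operator `∂/∂x₋₁ - ∂/∂x₋₁'`. -/
def hirotaDiffNeg (F : ℝ × ℝ → ℝ × ℝ → ℂ) : ℝ × ℝ → ℝ × ℝ → ℂ := fun x x' =>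
  deriv (fun s : ℝ => F (x.1, s) x') x.2 - deriv (fun s : ℝ => F x (x'.1, s)) x'.2

/-- The Hirota bilinear derivative `D_{x₁}^m D_{x₋₁}^k a · b`, a function of `x = (x₁, x₋₁)`:
apply `(∂/∂x₁ - ∂/∂x₁')^m (∂/∂x₋₁ - ∂/∂x₋₁')^k` to `a(x) b(x')` and put `x' = x`. -/
def hirotaD (m k : ℕ) (a b : ℝ × ℝ → ℂ) (x : ℝ × ℝ) : ℂ :=
  (hirotaDiffPos^[m] (hirotaDiffNeg^[k] (fun y y' => a y * b y'))) x x

/-- The phase `ξ = p x₁ + x₋₁ / p + ξ₀`. -/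
def todaPhase (p ξ₀ : ℂ) (x : ℝ × ℝ) : ℂ := p * (x.1 : ℂ) + 1 / p * (x.2 : ℂ) + ξ₀

/-- The entry `ψ_{i,j}^{(n)}`. Indices run over `Fin (2 * N)`, so that `Fin.rev i` stands for the
index `2N + 1 - i` of the numbering from `1` to `2N`, and `c_{i,j} = δ_{j,2N+1-i} c_i`. -/
def todaPsi {N : ℕ} (p c ξ₀ : Fin (2 * N) → ℂ) (n : ℤ) (x : ℝ × ℝ) (i j : Fin (2 * N)) : ℂ :=
  (if j = Fin.rev i then c i else 0) +
    2 * p i / (p i + p j) * (-(p i / p j)) ^ (n - 1) *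
      Complex.exp (todaPhase (p i) (ξ₀ i) x + todaPhase (p j) (ξ₀ j) x)

/-- `τ_n = det (ψ_{i,j}^{(n)})`, a determinant of size `2N`, as a function of `x = (x₁, x₋₁)`. -/
def todaTau {N : ℕ} (p c ξ₀ : Fin (2 * N) → ℂ) (n : ℤ) (x : ℝ × ℝ) : ℂ :=
  (Matrix.of (todaPsi p c ξ₀ n x)).det

end

open Matrix

/-! ### Derivatives and rank-one perturbations of determinants. -/

section Determinant

/-! Writing `ψⁿ` for the matrix, `φⁿ` and `χⁿ` for the wave and adjoint wave vectors, the shift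
`ψⁿ⁺¹ - ψⁿ` and both partial derivatives of `ψⁿ` have rank one, with factors among the `φ` and `χ`.
The matrix determinant lemma and Jacobi's formula then express everything through `a = χⁿ adj(ψⁿ)
φⁿ` and `b = χⁿ⁻¹ adj(ψⁿ) φⁿ⁻¹`, and the Toda equation becomes the factorisation `(τ + 2a)(τ - 2b)`
of `τₙ₊₁ τₙ₋₁` (`todaTau_bilinear`). Adjugates replace inverses since `τₙ` may vanish.

The conditions on `c` and `p` enter only in the reductions `τ₀ = τ₁` (`todaTau_zero_eq_one`) and
`τₙ₊₃ = τₙ` (`todaTau_add_three`), which turn the cases `n = 1, 2` into the two stated equations. -/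

theorem trace_mul_vecMulVec {ι : Type*} [Fintype ι] (A : Matrix ι ι ℂ) (u v : ι → ℂ) :
    (A * vecMulVec u v).trace = v ⬝ᵥ A *ᵥ u := by
  rw [mul_vecMulVec, trace_vecMulVec, dotProduct_comm]

variable {ι : Type*} [Fintype ι] [DecidableEq ι]

/-- Jacobi's formula for the derivative of a determinant. -/
theorem hasDerivAt_det {M : ℝ → Matrix ι ι ℂ} {M' : Matrix ι ι ℂ} {t : ℝ}
    (h : ∀ i j, HasDerivAt (fun s => M s i j) (M' i j) t) :
    HasDerivAt (fun s => (M s).det) ((M t).adjugate * M').trace t := by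
  have key : HasDerivAt (fun s => (M s).det)
      (∑ σ : Equiv.Perm ι, ((Equiv.Perm.sign σ : ℤ) : ℂ) *
        ∑ i, (∏ j ∈ Finset.univ.erase i, M t j (σ j)) * M' i (σ i)) t := by
    have e : (fun s => (M s).det) = fun s => ∑ σ : Equiv.Perm ι,
        ((Equiv.Perm.sign σ : ℤ) : ℂ) * ∏ i, M s i (σ i) := by
      funext s
      rw [← det_transpose, det_apply']
      rfl
    rw [e]
    refine HasDerivAt.fun_sum fun σ _ => HasDerivAt.const_mul _ ?_
    simpa using HasDerivAt.fun_finsetProd (u := Finset.univ) fun i _ => h i (σ i)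
  convert key using 1
  have row : ∀ i, (M' * (M t).adjugate) i i = ((M t).updateRow i (M' i)).det := by
    intro i
    rw [← cramer_transpose_apply, cramer_eq_adjugate_mulVec, ← adjugate_transpose,
      mulVec_transpose]
    rfl
  rw [trace_mul_comm, trace]
  simp only [diag_apply, row]
  simp_rw [Finset.mul_sum]
  rw [Finset.sum_comm]
  refine Finset.sum_congr rfl fun i _ => ?_
  rw [← det_transpose, det_apply']
  refine Finset.sum_congr rfl fun σ _ => ?_
  simp only [transpose_apply]
  rw [← Finset.prod_erase_mul _ _ (Finset.mem_univ i), updateRow_self]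
  congr 2
  refine Finset.prod_congr rfl fun j hj => ?_
  rw [updateRow_ne (Finset.ne_of_mem_erase hj)]

/-- The derivative of the adjugate, multiplied by the determinant. -/
theorem exists_hasDerivAt_adjugate {M : ℝ → Matrix ι ι ℂ} {M' : Matrix ι ι ℂ} {t : ℝ}
    (h : ∀ i j, HasDerivAt (fun s => M s i j) (M' i j) t) :
    ∃ A' : Matrix ι ι ℂ, (∀ i j, HasDerivAt (fun s => (M s).adjugate i j) (A' i j) t) ∧
      (M t).det • A' = ((M t).adjugate * M').trace • (M t).adjugate
        - (M t).adjugate * M' * (M t).adjugate := by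
  have hex : ∀ i j, ∃ a, HasDerivAt (fun s => (M s).adjugate i j) a t := by
    intro i j
    simp_rw [adjugate_apply]
    -- An adjugate entry is the determinant with row `j` replaced by a constant vector, so that row
    -- has derivative zero.
    refine ⟨_, hasDerivAt_det (M' := M'.updateRow j 0) fun k l => ?_⟩
    rcases eq_or_ne k j with rfl | hk
    · simpa using hasDerivAt_const t _
    · simpa [updateRow_ne hk] using h k l
  choose A' hA' using hex
  refine ⟨of A', hA', ?_⟩
  -- Differentiate `adj M * M = det M • 1`; right multiplication by `adj M` then gives the claim.
  have hprod : of A' * M t + (M t).adjugate * M' =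
      ((M t).adjugate * M').trace • (1 : Matrix ι ι ℂ) := by
    ext i j
    have h1 : HasDerivAt (fun s => ((M s).adjugate * M s) i j)
        (∑ k, (A' i k * M t k j + (M t).adjugate i k * M' k j)) t := by
      simp_rw [mul_apply]
      exact HasDerivAt.fun_sum fun k _ => (hA' i k).fun_mul (h k j)
    have h2 : HasDerivAt (fun s => ((M s).adjugate * M s) i j)
        (((M t).adjugate * M').trace * (1 : Matrix ι ι ℂ) i j) t := by
      simp_rw [adjugate_mul, Matrix.smul_apply, smul_eq_mul]
      exact (hasDerivAt_det h).mul_const _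
    rw [Matrix.add_apply, mul_apply, mul_apply, ← Finset.sum_add_distrib, Matrix.smul_apply, smul_eq_mul]
    exact h1.unique h2
  have := congrArg (· * (M t).adjugate) hprod
  simp only [add_mul, Matrix.mul_assoc, mul_adjugate, smul_mul, Matrix.mul_smul,
    Matrix.mul_one, Matrix.one_mul] at this
  rw [eq_sub_iff_add_eq, ← this, Matrix.mul_assoc]

/-- The matrix determinant lemma, without an invertibility assumption. -/
theorem det_add_vecMulVec (M : Matrix ι ι ℂ) (u v : ι → ℂ) :
    (M + vecMulVec u v).det = M.det + v ⬝ᵥ M.adjugate *ᵥ u := by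
  have hinv : ∀ A : Matrix ι ι ℂ, A.det ≠ 0 →
      (A + vecMulVec u v).det = A.det + v ⬝ᵥ A.adjugate *ᵥ u := by
    intro A hA
    rw [vecMulVec_eq Unit, det_add_replicateCol_mul_replicateRow hA.isUnit, det_unique (n := Unit)]
    rw [Matrix.add_apply, one_apply_eq, mul_add, mul_one]
    congr 1
    rw [inv_def, Ring.inverse_eq_inv', Matrix.mul_smul, smul_mul, Matrix.smul_apply, smul_eq_mul,
      mul_inv_cancel_left₀ hA]
    rw [dotProduct_mulVec]
    simp [mul_apply, dotProduct, vecMul]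
  -- `M + t • 1` is singular only at finitely many `t`, so the invertible case extends to `t = 0` by
  -- continuity.
  have hfin : {t : ℂ | (scalar ι t - -M).det = 0}.Finite := by
    have : {t : ℂ | (scalar ι t - -M).det = 0} = (-M).charpoly.rootSet ℂ := by
      ext t
      rw [Polynomial.mem_rootSet, Set.mem_ofPred_eq, ← eval_charpoly]
      simp [(charpoly_monic (-M)).ne_zero, Polynomial.aeval_def]
    rw [this]
    exact Polynomial.rootSet_finite _ _
  have hdense : Dense {t : ℂ | (scalar ι t - -M).det = 0}ᶜ := hfin.countable.dense_compl ℂ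
  have hcont : Continuous fun t : ℂ => scalar ι t - -M := by
    refine continuous_matrix fun i j => ?_
    simp only [Matrix.sub_apply, scalar_apply, diagonal_apply]
    split_ifs <;> fun_prop
  have heq := Continuous.ext_on hdense
    (f := fun t : ℂ => (scalar ι t - -M + vecMulVec u v).det)
    (g := fun t : ℂ => (scalar ι t - -M).det + v ⬝ᵥ (scalar ι t - -M).adjugate *ᵥ u)
    (hcont.add continuous_const).matrix_det
    (hcont.matrix_det.add
      (continuous_const.dotProduct (hcont.matrix_adjugate.matrix_mulVec continuous_const)))
    fun t ht => hinv _ ht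
  simpa using congrFun heq 0

end Determinant

theorem hirotaD_one_one_self {a ax ay : ℝ × ℝ → ℂ} {axy : ℂ} {x : ℝ × ℝ}
    (hx : ∀ y : ℝ × ℝ, HasDerivAt (fun s : ℝ => a (s, y.2)) (ax y) y.1)
    (hy : ∀ y : ℝ × ℝ, HasDerivAt (fun s : ℝ => a (y.1, s)) (ay y) y.2)
    (hxy : HasDerivAt (fun s : ℝ => ay (s, x.2)) axy x.1) :
    hirotaD 1 1 a a x = 2 * (a x * axy - ax x * ay x) := by
  have hneg : hirotaDiffNeg (fun y y' => a y * a y') = fun y y' => ay y * a y' - a y * ay y' := by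
    funext y y'
    simp only [hirotaDiffNeg]
    rw [((hy y).mul_const (a y')).deriv, ((hy y').const_mul (a y)).deriv]
  simp only [hirotaD, Function.iterate_one, hneg, hirotaDiffPos]
  rw [((hxy.mul_const (a x)).fun_sub ((hx x).mul_const (ay x))).deriv,
    (((hx x).const_mul (ay x)).fun_sub (hxy.const_mul (a x))).deriv]
  ring

/-! ### The Gram-type tau functions and their reductions. -/

section Toda

variable {N : ℕ} {p : Fin (2 * N) → ℂ} (c ξ₀ : Fin (2 * N) → ℂ)

noncomputable section

/-- The wave function `φ^{(n)}_i = p_i^n exp ξ_i`. -/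
def todaWave (p ξ₀ : Fin (2 * N) → ℂ) (n : ℤ) (x : ℝ × ℝ) (i : Fin (2 * N)) : ℂ :=
  p i ^ n * Complex.exp (todaPhase (p i) (ξ₀ i) x)

/-- The adjoint wave function `χ^{(n)}_j = (-p_j)^{-n} exp ξ_j`. -/
def todaAdjWave (p ξ₀ : Fin (2 * N) → ℂ) (n : ℤ) (x : ℝ × ℝ) (j : Fin (2 * N)) : ℂ :=
  (-p j) ^ (-n) * Complex.exp (todaPhase (p j) (ξ₀ j) x)

end

theorem hasDerivAt_todaPhase_fst (q η : ℂ) (x : ℝ × ℝ) :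
    HasDerivAt (fun s : ℝ => todaPhase q η (s, x.2)) q x.1 := by
  unfold todaPhase
  simpa using
    (((Complex.ofRealCLM.hasDerivAt (x := x.1)).const_mul q).add_const
      (1 / q * (x.2 : ℂ))).add_const η

theorem hasDerivAt_todaPhase_snd (q η : ℂ) (x : ℝ × ℝ) :
    HasDerivAt (fun s : ℝ => todaPhase q η (x.1, s)) (1 / q) x.2 := by
  unfold todaPhase
  simpa using
    (((Complex.ofRealCLM.hasDerivAt (x := x.2)).const_mul (1 / q)).const_add
      (q * (x.1 : ℂ))).add_const η

theorem todaPsi_add_one (hp_add : ∀ i j, p i + p j ≠ 0) (n : ℤ) (x : ℝ × ℝ) :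
    of (todaPsi p c ξ₀ (n + 1) x) =
      of (todaPsi p c ξ₀ n x) +
        vecMulVec ((2 : ℂ) • todaWave p ξ₀ n x) (todaAdjWave p ξ₀ n x) := by
  ext i j
  have h0 : ∀ i, p i ≠ 0 := fun i h => hp_add i i (by simp [h])
  have hi := h0 i
  have hj := h0 j
  have hij := hp_add i j
  have hd : -(p i / p j) ≠ 0 := neg_ne_zero.2 (div_ne_zero hi hj)
  have e : (-(p i / p j)) ^ n = p i ^ n * (-p j) ^ (-n) := by
    rw [_root_.zpow_neg, ← div_eq_mul_inv, ← div_zpow, div_neg]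
  simp only [Matrix.add_apply, of_apply, todaPsi, vecMulVec_apply, Pi.smul_apply, smul_eq_mul, todaWave,
    todaAdjWave, Complex.exp_add, add_sub_cancel_right]
  rw [zpow_sub_one₀ hd]
  rw [show 2 * (p i ^ n * Complex.exp (todaPhase (p i) (ξ₀ i) x)) *
    ((-p j) ^ (-n) * Complex.exp (todaPhase (p j) (ξ₀ j) x)) = 2 * (-(p i / p j)) ^ n *
      (Complex.exp (todaPhase (p i) (ξ₀ i) x) * Complex.exp (todaPhase (p j) (ξ₀ j) x)) by
    rw [e]; ring]
  generalize (-(p i / p j)) ^ n = w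
  field_simp
  ring

/-- Differentiating the exponential produces the factor `p i + p j`, which cancels the denominator
and leaves a product of a function of `i` and one of `j`. -/
theorem hasDerivAt_todaPsi_fst (hp_add : ∀ i j, p i + p j ≠ 0) (n : ℤ) (x : ℝ × ℝ)
    (i j : Fin (2 * N)) :
    HasDerivAt (fun s : ℝ => of (todaPsi p c ξ₀ n (s, x.2)) i j)
      (vecMulVec ((2 : ℂ) • todaWave p ξ₀ n x) (todaAdjWave p ξ₀ (n - 1) x) i j) x.1 := by
  have h0 : ∀ i, p i ≠ 0 := fun i h => hp_add i i (by simp [h])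
  have hi := h0 i
  have hij := hp_add i j
  have := ((((hasDerivAt_todaPhase_fst (p i) (ξ₀ i) x).add
    (hasDerivAt_todaPhase_fst (p j) (ξ₀ j) x)).cexp.const_mul
      (2 * p i / (p i + p j) * (-(p i / p j)) ^ (n - 1))).const_add
        (if j = Fin.rev i then c i else 0))
  refine this.congr_deriv ?_
  have e : (-(p i / p j)) ^ (n - 1) = p i ^ (n - 1) * (-p j) ^ (-(n - 1)) := by
    rw [_root_.zpow_neg, ← div_eq_mul_inv, ← div_zpow, div_neg]
  simp only [Pi.add_apply, vecMulVec_apply, Pi.smul_apply, smul_eq_mul, todaWave, todaAdjWave,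
    Complex.exp_add, e, zpow_sub_one₀ hi]
  field_simp

theorem hasDerivAt_todaPsi_snd (hp_add : ∀ i j, p i + p j ≠ 0) (n : ℤ) (x : ℝ × ℝ)
    (i j : Fin (2 * N)) :
    HasDerivAt (fun s : ℝ => of (todaPsi p c ξ₀ n (x.1, s)) i j)
      (vecMulVec ((-2 : ℂ) • todaWave p ξ₀ (n - 1) x) (todaAdjWave p ξ₀ n x) i j) x.2 := by
  have h0 : ∀ i, p i ≠ 0 := fun i h => hp_add i i (by simp [h])
  have hi := h0 i
  have hj := h0 j
  have hij := hp_add i j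
  have := ((((hasDerivAt_todaPhase_snd (p i) (ξ₀ i) x).add
    (hasDerivAt_todaPhase_snd (p j) (ξ₀ j) x)).cexp.const_mul
      (2 * p i / (p i + p j) * (-(p i / p j)) ^ (n - 1))).const_add
        (if j = Fin.rev i then c i else 0))
  refine this.congr_deriv ?_
  have e : (-(p i / p j)) ^ (n - 1) = p i ^ (n - 1) * ((-p j) ^ (-n) * -p j) := by
    rw [← zpow_add_one₀ (neg_ne_zero.2 hj), show -n + 1 = -(n - 1) by ring,
      _root_.zpow_neg, ← div_eq_mul_inv, ← div_zpow, div_neg]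
  simp only [Pi.add_apply, vecMulVec_apply, Pi.smul_apply, smul_eq_mul, todaWave, todaAdjWave,
    Complex.exp_add, e]
  field_simp
  ring

theorem hasDerivAt_todaWave_fst (hp : ∀ i, p i ≠ 0) (n : ℤ) (x : ℝ × ℝ) (i : Fin (2 * N)) :
    HasDerivAt (fun s : ℝ => todaWave p ξ₀ n (s, x.2) i) (todaWave p ξ₀ (n + 1) x i) x.1 := by
  refine ((hasDerivAt_todaPhase_fst (p i) (ξ₀ i) x).cexp.const_mul (p i ^ n)).congr_deriv ?_
  simp only [todaWave, zpow_add_one₀ (hp i)]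
  ring

theorem hasDerivAt_todaAdjWave_fst (hp : ∀ i, p i ≠ 0) (n : ℤ) (x : ℝ × ℝ) (j : Fin (2 * N)) :
    HasDerivAt (fun s : ℝ => todaAdjWave p ξ₀ n (s, x.2) j) (-todaAdjWave p ξ₀ (n - 1) x j) x.1 := by
  refine ((hasDerivAt_todaPhase_fst (p j) (ξ₀ j) x).cexp.const_mul ((-p j) ^ (-n))).congr_deriv ?_
  simp only [todaAdjWave, show -(n - 1) = -n + 1 by ring, zpow_add_one₀ (neg_ne_zero.2 (hp j))]
  ring

/-- The bilinear equation of the two-dimensional Toda lattice, for arbitrary constants `c i`. -/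
theorem todaTau_bilinear (hp_add : ∀ i j, p i + p j ≠ 0) (n : ℤ) (x : ℝ × ℝ) :
    -(1 / 2 * hirotaD 1 1 (todaTau p c ξ₀ n) (todaTau p c ξ₀ n) x
        - todaTau p c ξ₀ n x * todaTau p c ξ₀ n x) =
      todaTau p c ξ₀ (n + 1) x * todaTau p c ξ₀ (n - 1) x := by
  have h0 : ∀ i, p i ≠ 0 := fun i h => hp_add i i (by simp [h])
  let M : ℝ × ℝ → Matrix (Fin (2 * N)) (Fin (2 * N)) ℂ := fun y => of (todaPsi p c ξ₀ n y)
  let My : ℝ × ℝ → Matrix (Fin (2 * N)) (Fin (2 * N)) ℂ := fun y =>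
    vecMulVec ((-2 : ℂ) • todaWave p ξ₀ (n - 1) y) (todaAdjWave p ξ₀ n y)
  let Mxy : Matrix (Fin (2 * N)) (Fin (2 * N)) ℂ :=
    vecMulVec ((-2 : ℂ) • todaWave p ξ₀ n x) (todaAdjWave p ξ₀ n x) +
      vecMulVec ((2 : ℂ) • todaWave p ξ₀ (n - 1) x) (todaAdjWave p ξ₀ (n - 1) x)
  have hx := fun y : ℝ × ℝ => hasDerivAt_det (hasDerivAt_todaPsi_fst c ξ₀ hp_add n y)
  have hy := fun y : ℝ × ℝ => hasDerivAt_det (hasDerivAt_todaPsi_snd c ξ₀ hp_add n y)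
  obtain ⟨A', hA', hA⟩ := exists_hasDerivAt_adjugate (hasDerivAt_todaPsi_fst c ξ₀ hp_add n x)
  have hMxy : ∀ i j, HasDerivAt (fun s : ℝ => My (s, x.2) i j) (Mxy i j) x.1 := by
    intro i j
    refine (((hasDerivAt_todaWave_fst ξ₀ h0 (n - 1) x i).const_mul (-2 : ℂ)).mul
      (hasDerivAt_todaAdjWave_fst ξ₀ h0 n x j)).congr_deriv ?_
    simp only [Mxy, Matrix.add_apply, vecMulVec_apply, Pi.smul_apply, smul_eq_mul, sub_add_cancel]
    ring
  have hxy : HasDerivAt (fun s : ℝ => ((M (s, x.2)).adjugate * My (s, x.2)).trace)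
      ((A' * My x).trace + ((M x).adjugate * Mxy).trace) x.1 := by
    rw [← trace_add]
    simp only [trace, diag_apply, Matrix.add_apply, mul_apply, ← Finset.sum_add_distrib]
    exact HasDerivAt.fun_sum fun i _ => HasDerivAt.fun_sum fun k _ =>
      (hA' i k).fun_mul (hMxy k i)
  have hD := hirotaD_one_one_self (a := todaTau p c ξ₀ n) hx hy hxy
  have hdet : todaTau p c ξ₀ n x = (M x).det := rfl
  have hplus : todaTau p c ξ₀ (n + 1) x =
      (M x).det + 2 * (todaAdjWave p ξ₀ n x ⬝ᵥ (M x).adjugate *ᵥ todaWave p ξ₀ n x) := by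
    rw [todaTau, todaPsi_add_one c ξ₀ hp_add, det_add_vecMulVec, mulVec_smul, dotProduct_smul,
      smul_eq_mul]
  have hminus : todaTau p c ξ₀ (n - 1) x = (M x).det - 2 *
      (todaAdjWave p ξ₀ (n - 1) x ⬝ᵥ (M x).adjugate *ᵥ todaWave p ξ₀ (n - 1) x) := by
    have e := todaPsi_add_one c ξ₀ hp_add (n - 1) x
    rw [sub_add_cancel, ← sub_eq_iff_eq_add, sub_eq_add_neg, ← neg_vecMulVec, ← neg_smul] at e
    rw [todaTau, ← e, det_add_vecMulVec, mulVec_smul, dotProduct_smul, smul_eq_mul]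
    ring
  -- The first resulting term is the product of the two first derivatives of `τₙ`, which cancels the
  -- one in the Hirota derivative.
  have hprod := congrArg (fun B => (B * My x).trace) hA
  simp only [smul_mul, sub_mul, trace_smul, trace_sub, smul_eq_mul] at hprod
  rw [hD, hplus, hminus, hdet, mul_add, show (M x).det * (A' * My x).trace = _ from hprod]
  have hquad : ((M x).adjugate * vecMulVec ((2 : ℂ) • todaWave p ξ₀ n x)
      (todaAdjWave p ξ₀ (n - 1) x) * (M x).adjugate * My x).trace =
      -4 * (todaAdjWave p ξ₀ n x ⬝ᵥ (M x).adjugate *ᵥ todaWave p ξ₀ n x) *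
        (todaAdjWave p ξ₀ (n - 1) x ⬝ᵥ (M x).adjugate *ᵥ todaWave p ξ₀ (n - 1) x) := by
    rw [Matrix.mul_assoc _ _ (My x), mul_vecMulVec, mul_vecMulVec, vecMulVec_mul_vecMulVec,
      trace_vecMulVec]
    simp only [mulVec_smul, dotProduct_smul, smul_dotProduct, smul_eq_mul]
    rw [dotProduct_comm _ (todaAdjWave p ξ₀ n x)]
    ring
  have hlin : ((M x).adjugate * Mxy).trace =
      -2 * (todaAdjWave p ξ₀ n x ⬝ᵥ (M x).adjugate *ᵥ todaWave p ξ₀ n x) +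
        2 * (todaAdjWave p ξ₀ (n - 1) x ⬝ᵥ (M x).adjugate *ᵥ todaWave p ξ₀ (n - 1) x) := by
    simp only [Mxy, Matrix.mul_add, trace_add, trace_mul_vecMulVec, mulVec_smul, dotProduct_smul,
      smul_eq_mul]
  rw [hquad, hlin]
  ring

theorem contDiff_todaTau (p : Fin (2 * N) → ℂ) (n : ℤ) : ContDiff ℝ ∞ (todaTau p c ξ₀ n) := by
  have e : todaTau p c ξ₀ n = fun x => ∑ σ : Equiv.Perm (Fin (2 * N)),
      ((Equiv.Perm.sign σ : ℤ) : ℂ) * ∏ i, todaPsi p c ξ₀ n x (σ i) i := by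
    funext x
    rw [todaTau, det_apply']
    rfl
  rw [e]
  refine ContDiff.sum fun σ _ => contDiff_const.mul (contDiff_prod fun i _ => ?_)
  have hphase : ∀ q η : ℂ, ContDiff ℝ ∞ (todaPhase q η) := fun q η =>
    ((contDiff_const.mul (Complex.ofRealCLM.contDiff.comp contDiff_fst)).add
      (contDiff_const.mul (Complex.ofRealCLM.contDiff.comp contDiff_snd))).add contDiff_const
  exact contDiff_const.add (contDiff_const.mul ((hphase _ _).add (hphase _ _)).cexp)

/-- Antisymmetry of `c` gives `ψ⁰ = -(ψ¹)ᵀ`, and the sign disappears because the size `2N` is even.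
-/
theorem todaTau_zero_eq_one (hp_add : ∀ i j, p i + p j ≠ 0) (hc : ∀ i, c i = -c (Fin.rev i))
    (x : ℝ × ℝ) : todaTau p c ξ₀ 0 x = todaTau p c ξ₀ 1 x := by
  have h0 : ∀ i, p i ≠ 0 := fun i h => hp_add i i (by simp [h])
  have e : of (todaPsi p c ξ₀ 0 x) = -(of (todaPsi p c ξ₀ 1 x))ᵀ := by
    ext i j
    simp only [Matrix.neg_apply, transpose_apply, of_apply, todaPsi]
    have hif : (if j = Fin.rev i then c i else 0) = -(if i = Fin.rev j then c j else 0) := by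
      by_cases h : j = Fin.rev i
      · subst h
        simp [hc i]
      · rw [if_neg h, if_neg fun h' => h (by rw [h', Fin.rev_rev]), neg_zero]
    have hi := h0 i
    have hj := h0 j
    have hij := hp_add i j
    have hji := hp_add j i
    rw [hif, add_comm (todaPhase (p j) _ _), add_comm (p j)]
    simp only [zero_sub, sub_self, zpow_zero, _root_.zpow_neg_one, mul_one]
    field_simp
    ring
  rw [todaTau, todaTau, e, det_neg, det_transpose]
  simp

/-- The shift by three rescales rows and columns by diagonal matrices whose determinants are
mutually inverse, again by even size. The constant part survives the rescaling because its scale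
factor is 1 wherever `j = Fin.rev i`. -/
theorem todaTau_add_three (hp_add : ∀ i j, p i + p j ≠ 0)
    (hp : ∀ i, p i ^ 2 - p i * p (Fin.rev i) + p (Fin.rev i) ^ 2 = 0) (n : ℤ) (x : ℝ × ℝ) :
    todaTau p c ξ₀ (n + 3) x = todaTau p c ξ₀ n x := by
  have h0 : ∀ i, p i ≠ 0 := fun i h => hp_add i i (by simp [h])
  have e : of (todaPsi p c ξ₀ (n + 3) x) =
      diagonal (fun i => p i ^ 3) * of (todaPsi p c ξ₀ n x) *
        diagonal (fun j => ((-p j) ^ 3)⁻¹) := by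
    ext i j
    have hi := h0 i
    have hj := h0 j
    rw [mul_diagonal, diagonal_mul]
    simp only [of_apply, todaPsi]
    have hd : -(p i / p j) ≠ 0 := neg_ne_zero.2 (div_ne_zero hi hj)
    have hpow : (-(p i / p j)) ^ (n + 3 - 1) =
        (-(p i / p j)) ^ (n - 1) * (p i ^ 3 * ((-p j) ^ 3)⁻¹) := by
      rw [show n + 3 - 1 = n - 1 + (3 : ℕ) by push_cast; ring, zpow_add₀ hd, zpow_natCast,
        ← div_eq_mul_inv, ← div_pow, div_neg]
    have hif : (if j = Fin.rev i then c i else 0) =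
        (if j = Fin.rev i then c i else 0) * (p i ^ 3 * ((-p j) ^ 3)⁻¹) := by
      split_ifs with h
      · subst h
        -- Here `p³ + q³ = (p + q)(p² - pq + q²)` vanishes.
        have hcube : p i ^ 3 = (-p (Fin.rev i)) ^ 3 := by
          linear_combination (p i + p (Fin.rev i)) * hp i
        rw [hcube, mul_inv_cancel₀ (pow_ne_zero 3 (neg_ne_zero.2 hj)), mul_one]
      · simp
    rw [hpow]
    nth_rewrite 1 [hif]
    ring
  have hprod : ∏ j, ((-p j) ^ 3)⁻¹ = (∏ i, p i ^ 3)⁻¹ := by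
    rw [Finset.prod_inv_distrib]
    congr 1
    simp_rw [Finset.prod_pow, Finset.prod_neg]
    simp
  rw [todaTau, e, det_mul, det_mul, det_diagonal, det_diagonal, hprod, mul_right_comm,
    mul_inv_cancel₀ (Finset.prod_ne_zero_iff.2 fun i _ => pow_ne_zero 3 (h0 i)), one_mul]
  rfl

end Toda

theorem mainTheorem5 (N : ℕ) (p c ξ₀ : Fin (2 * N) → ℂ)
    (hp_add : ∀ i j, p i + p j ≠ 0)
    (hp : ∀ i, p i ^ 2 - p i * p (Fin.rev i) + p (Fin.rev i) ^ 2 = 0)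
    (hc : ∀ i, c i = -c (Fin.rev i)) :
    (∀ n : ℤ, ContDiff ℝ ∞ (todaTau p c ξ₀ n)) ∧
    (∀ x : ℝ × ℝ,
      -(1 / 2 * hirotaD 1 1 (todaTau p c ξ₀ 1) (todaTau p c ξ₀ 1) x
          - todaTau p c ξ₀ 1 x * todaTau p c ξ₀ 1 x)
        = todaTau p c ξ₀ 1 x * todaTau p c ξ₀ 2 x) ∧
    (∀ x : ℝ × ℝ,
      -(1 / 2 * hirotaD 1 1 (todaTau p c ξ₀ 2) (todaTau p c ξ₀ 2) x
          - todaTau p c ξ₀ 2 x * todaTau p c ξ₀ 2 x)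
        = todaTau p c ξ₀ 1 x ^ 2) ∧
    (∀ (n : ℤ) (x : ℝ × ℝ), todaTau p c ξ₀ (n + 3) x = todaTau p c ξ₀ n x) := by
  refine ⟨contDiff_todaTau c ξ₀ p, fun x => ?_, fun x => ?_, fun n x =>
    todaTau_add_three c ξ₀ hp_add hp n x⟩
  · rw [todaTau_bilinear c ξ₀ hp_add, sub_self, todaTau_zero_eq_one c ξ₀ hp_add hc, mul_comm]
    rfl
  · rw [todaTau_bilinear c ξ₀ hp_add, show (2 : ℤ) + 1 = 0 + 3 by norm_num,
      todaTau_add_three c ξ₀ hp_add hp, todaTau_zero_eq_one c ξ₀ hp_add hc, sq]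
    rfl
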